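/- Let $\mathfrak A$ be a unital C$^*$-algebra of real rank zero (the invertible self-adjoint elements are dense in the self-adjoint elements) and let $\tau$ be a faithful tracial state on $\mathfrak A$. Assume that $\mathfrak A$ has strong comparison of projections with respect to $\tau$: for all projections $P,Q\in\mathfrak A$ with $\tau(P)\le\tau(Q)$ there is $V\in\mathfrak A$ such that $V^*V=P$ and $VV^*$ is a projection with $VV^*\le Q$. For $\epsilon>0$ let $f_\epsilon:[0,\infty)\to[0,1]$ be the continuous function with $f_\epsilon=0$ on $[0,\epsilon/2]$, $f_\epsilon=1$ on $[\epsilon,\infty)$, and $f_\epsilon$ linear on $[\epsilon/2,\epsilon]$. For positive $a\in\mathfrak A$ let $d_\tau(a)=\lim_{\epsilon\to0^+}\tau(f_\epsilon(a))$, and for self-adjoint $T\in\mathfrak A$ and $s\in[0,1)$ let $$\lambda^\tau_T(s)=\inf\{t\in\mathbb R : d_\tau((T-t1)_+)\le s\}.$$ For bounded measurable $f:[0,1]\to\mathbb R$ let $f^*(s)=\inf\{t\in\mathbb R : |\{x\in[0,1]: f(x)>t\}|\le s\}$ be its non-increasing rearrangement, where $|\cdot|$ is Lebesgue measure. For self-adjoint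 $S,T\in\mathfrak A$ write $S\prec_\tau T$ ($T$ majorizes $S$) if $\int_0^t(\lambda^\tau_S)^*(s)\,ds\le\int_0^t(\lambda^\tau_T)^*(s)\,ds$ for all $t\in[0,1]$, with equality at $t=1$. Let $\mathcal U(T)=\{U^*TU : U\in\mathfrak A\text{ unitary}\}$, let $\mathrm{dist}(X,Y)=\inf\{\|x-y\| : x\in X,\ y\in Y\}$, and call $S$ and $T$ approximately unitarily equivalent if $\overline{\mathcal U(S)}=\overline{\mathcal U(T)}$ (norm closures). Then for all self-adjoint $S,T\in\mathfrak A$ $$\mathrm{dist}(\mathcal U(S),\mathcal U(T))=\sup\{|\lambda^\tau_S(s)-\lambda^\tau_T(s)| : s\in[0,1)\}.$$ Moreover, the following are equivalent: (i) $S$ and $T$ are approximately unitarily equivalent; (ii) $\lambda^\tau_S(s)=\lambda^\tau_T(s)$ for all $s\in[0,1)$; (iii) $S\prec_\tau T$ and $T\prec_\tau S$. -/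

import Mathlib

open scoped ComplexOrder Topology
open Filter

noncomputable section

/-- The unitary orbit `{U* T U | U unitary}`. -/
def unitaryOrbit {A : Type*} [CStarAlgebra A] (T : A) : Set A :=
  {X | ∃ U ∈ unitary A, X = star U * T * U}

/-- Approximate unitary equivalence: the norm-closed unitary orbits coincide. -/
def ApproxUnitarilyEquivalent {A : Type*} [CStarAlgebra A] (S T : A) : Prop :=
  closure (unitaryOrbit S) = closure (unitaryOrbit T)

/-- The distance `inf {‖x - y‖ | x ∈ X, y ∈ Y}` between two nonempty subsets. -/
def distBetween {A : Type*} [CStarAlgebra A] (X Y : Set A) : ℝ :=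
  sInf {r : ℝ | ∃ x ∈ X, ∃ y ∈ Y, r = ‖x - y‖}

/-- A unital C*-algebra has real rank zero if its invertible self-adjoint elements are dense
in its self-adjoint elements. -/
def HasRealRankZero (A : Type*) [CStarAlgebra A] : Prop :=
  ∀ a : A, IsSelfAdjoint a → a ∈ closure {b : A | IsSelfAdjoint b ∧ IsUnit b}

/-- Murray-von Neumann equivalence of projections. -/
def ProjectionEquiv {A : Type*} [CStarAlgebra A] (P Q : A) : Prop :=
  ∃ V : A, P = star V * V ∧ Q = V * star V

section Tracial

variable {A : Type*} [CStarAlgebra A] [PartialOrder A] [StarOrderedRing A]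

/-- `P` is equivalent to a subprojection of `Q`. -/
def ProjectionSubequiv (P Q : A) : Prop :=
  ∃ Q' : A, IsStarProjection Q' ∧ Q' ≤ Q ∧ ProjectionEquiv P Q'

/-- A positive linear functional is a faithful tracial state. -/
structure IsFaithfulTracialState (τ : A →ₚ[ℂ] ℂ) : Prop where
  map_one : τ 1 = 1
  map_mul_comm : ∀ a b : A, τ (a * b) = τ (b * a)
  faithful : ∀ a : A, τ (star a * a) = 0 → a = 0

/-- Strong comparison of projections with respect to `τ`. -/
def HasStrongComparison (τ : A →ₚ[ℂ] ℂ) : Prop :=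
  ∀ P Q : A, IsStarProjection P → IsStarProjection Q → τ P ≤ τ Q → ProjectionSubequiv P Q

/-- For `ε > 0`, the continuous function equal to `0` on `[0, ε/2]`, equal to `1` on `[ε, ∞)`,
and linear in between. -/
def cutoffFun (ε x : ℝ) : ℝ := max 0 (min 1 (2 * x / ε - 1))

/-- The dimension function `d_τ(a) = lim_{ε → 0+} τ(f_ε(a))` of a positive element `a`.
Here `f_ε = cutoffFun ε`; the limit exists since the (real) numbers `τ(f_ε(a)) ∈ [0, 1]`
increase as `ε` decreases. -/
def dimFun (τ : A →ₚ[ℂ] ℂ) (a : A) : ℝ :=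
  limUnder (𝓝[>] (0 : ℝ)) (fun ε : ℝ => (τ (cfc (cutoffFun ε) a)).re)

/-- The eigenvalue function of a self-adjoint `T`, for `s ∈ [0, 1)`; `(·)⁺` is the positive part
given by the functional calculus. -/
def eigenvalueFun (τ : A →ₚ[ℂ] ℂ) (T : A) (s : ℝ) : ℝ :=
  sInf {t : ℝ | dimFun τ ((T - algebraMap ℝ A t)⁺) ≤ s}

end Tracial

/-- The non-increasing rearrangement of a bounded measurable real function on `[0, 1]`. -/
def decreasingRearrangement (f : ℝ → ℝ) (s : ℝ) : ℝ :=
  sInf {t : ℝ | MeasureTheory.volume {x ∈ Set.Icc (0 : ℝ) 1 | t < f x} ≤ ENNReal.ofReal s}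

/-- `f` majorizes `g` (written `g ≺ f`), for bounded measurable real functions on `[0, 1]`.
Only the values almost everywhere matter, so functions on `[0, 1)` are allowed too. -/
def FunMajorizes (f g : ℝ → ℝ) : Prop :=
  (∀ t ∈ Set.Icc (0 : ℝ) 1,
    ∫ s in (0 : ℝ)..t, decreasingRearrangement g s
      ≤ ∫ s in (0 : ℝ)..t, decreasingRearrangement f s) ∧
  ∫ s in (0 : ℝ)..1, decreasingRearrangement g s = ∫ s in (0 : ℝ)..1, decreasingRearrangement f s

/-- `T` majorizes `S` with respect to `τ` (written `S ≺_τ T`). -/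
def TraceMajorizes {A : Type*} [CStarAlgebra A] [PartialOrder A] [StarOrderedRing A]
    (τ : A →ₚ[ℂ] ℂ) (T S : A) : Prop :=
  FunMajorizes (eigenvalueFun τ T) (eigenvalueFun τ S)

end

/-!
The number `d_τ((T - t)₊)` (`upperMass τ T t`) is the trace of the spectral part of `T` above `t`,
and the eigenvalue function is its generalized inverse: `λ_T(s) ≤ t ↔ d_τ((T - t)₊) ≤ s` on `[0, 1)`
(`eigenvalueFun_le_iff`, which rests on right-continuity in `t`).

*Lower bound for the distance.* If `S ≤ T`, then `τ(h(S)) ≤ τ(h(T))` for every nondecreasing `C¹`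
function `h` (`realTrace_cfc_mono`). For a polynomial this holds because `u ↦ τ(h(S + u(T - S)))`
has the nonnegative derivative `τ(h'(S + u(T - S)) (T - S))`; the general case follows by
approximating `h'` by polynomials. Hence `d_τ((S - t)₊) ≤ d_τ((T - t)₊)`, and since `S ≤ T + ‖S - T‖`,
the eigenvalue functions differ by at most `‖S - T‖` (`abs_eigenvalueFun_sub_le`). They are unitarily
invariant.

*Upper bound.* In real rank zero, a small perturbation opens gaps in the spectrum of a self-adjoint
element at all points of a fine grid, as each gap is an open dense condition. The spectral
projections between the gaps give an approximation by a finite weighted sum `∑ c • p` of orthogonal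
projections with sum `1`, such that the step function with value `c` on an interval of length `τ(p)`
approximates the eigenvalue function (`HasRealRankZero.exists_weightedSum_near`). Two such sums are
matched by repeatedly comparing their leading projections: strong comparison embeds the one of
smaller trace into the other, and what remains is treated in the same way. The resulting partial
isometries add up to a unitary `U`, and the values of the two step functions on the matched pieces
bound the norm of the difference (`exists_intertwiner`, `exists_unitary_norm_sub_le`).

Approximate unitary equivalence means distance zero between the orbits. Finally, the eigenvalue
function is its own decreasing rearrangement, so mutual majorization says that the integrals of
`λ_S` and `λ_T` over every `[0, t]` agree, and right-continuity then forces `λ_S = λ_T`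
(`traceMajorizes_antisymm_iff`).
-/

noncomputable section

variable {A : Type*} [CStarAlgebra A] [PartialOrder A] [StarOrderedRing A]

/-! ### The real-valued trace -/

/-- The real part of a positive functional, as a continuous real-linear functional. -/
def realTrace (τ : A →ₚ[ℂ] ℂ) : A →L[ℝ] ℝ :=
  Complex.reCLM.comp ((ContinuousLinearMap.mk τ.toLinearMap (map_continuous τ)).restrictScalars ℝ)

lemma realTrace_apply (τ : A →ₚ[ℂ] ℂ) (a : A) : realTrace τ a = (τ a).re := rfl

lemma realTrace_mono (τ : A →ₚ[ℂ] ℂ) {a b : A} (h : a ≤ b) : realTrace τ a ≤ realTrace τ b :=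
  (Complex.le_def.1 (OrderHomClass.mono τ h)).1

lemma realTrace_nonneg (τ : A →ₚ[ℂ] ℂ) {a : A} (h : 0 ≤ a) : 0 ≤ realTrace τ a := by
  simpa using realTrace_mono τ h

lemma ofReal_realTrace (τ : A →ₚ[ℂ] ℂ) {a : A} (h : 0 ≤ a) : (realTrace τ a : ℂ) = τ a := by
  have h1 : 0 ≤ τ a := by simpa using OrderHomClass.mono τ h
  exact (Complex.eq_re_of_ofReal_le (r := 0) (by simpa using h1)).symm

namespace IsFaithfulTracialState

variable {τ : A →ₚ[ℂ] ℂ}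

lemma realTrace_one (hτ : IsFaithfulTracialState τ) : realTrace τ 1 = 1 := by
  simp [realTrace_apply, hτ.map_one]

lemma realTrace_algebraMap (hτ : IsFaithfulTracialState τ) (r : ℝ) :
    realTrace τ (algebraMap ℝ A r) = r := by
  simp [Algebra.algebraMap_eq_smul_one, hτ.realTrace_one]

lemma realTrace_mul_comm (hτ : IsFaithfulTracialState τ) (a b : A) :
    realTrace τ (a * b) = realTrace τ (b * a) := by
  simp [realTrace_apply, hτ.map_mul_comm a b]

lemma realTrace_mul_nonneg (hτ : IsFaithfulTracialState τ) {a b : A} (ha : 0 ≤ a) (hb : 0 ≤ b) :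
    0 ≤ realTrace τ (a * b) := by
  have h : realTrace τ (a * b) = realTrace τ (star (CFC.sqrt a) * b * CFC.sqrt a) := by
    rw [(CFC.sqrt_nonneg a).isSelfAdjoint.star_eq, hτ.realTrace_mul_comm _ (CFC.sqrt a),
      ← mul_assoc, CFC.sqrt_mul_sqrt_self a]
  rw [h]
  exact realTrace_nonneg τ (star_left_conjugate_nonneg hb _)

lemma eq_zero_of_realTrace_eq_zero (hτ : IsFaithfulTracialState τ) {p : A}
    (hp : IsStarProjection p) (h : realTrace τ p = 0) : p = 0 := by
  apply hτ.faithful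
  rw [hp.isSelfAdjoint.star_eq, hp.isIdempotentElem.eq, ← ofReal_realTrace τ hp.nonneg, h,
    Complex.ofReal_zero]

end IsFaithfulTracialState

/-! ### Monotonicity of the trace of a functional calculus -/

/-- The derivative of `u ↦ τ(p(S + uD))` is `τ(p'(S + uD) D)`. -/
lemma hasDerivAt_realTrace_aeval {τ : A →ₚ[ℂ] ℂ} (hτ : IsFaithfulTracialState τ) (S D : A)
    (p : Polynomial ℝ) (u : ℝ) :
    HasDerivAt (fun u : ℝ => realTrace τ (Polynomial.aeval (S + u • D) p))
      (realTrace τ (Polynomial.aeval (S + u • D) (Polynomial.derivative p) * D)) u := by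
  induction p using Polynomial.induction_on' with
  | add p q hp hq =>
    simp only [map_add, add_mul]
    exact hp.add hq
  | monomial n a =>
    have h1 : HasDerivAt (fun u : ℝ => S + u • D) D u := by
      simpa using ((hasDerivAt_id u).smul_const D).const_add S
    have h2 := ((realTrace τ).hasFDerivAt.comp_hasDerivAt u (h1.fun_pow' n)).const_mul a
    have h3 : ∀ i ∈ Finset.range n, realTrace τ ((S + u • D) ^ (n.pred - i) * D * (S + u • D) ^ i)
        = realTrace τ ((S + u • D) ^ (n - 1) * D) := by
      intro i hi
      rw [hτ.realTrace_mul_comm, ← mul_assoc, ← pow_add]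
      congr 3
      have := Finset.mem_range.1 hi
      simp only [Nat.pred_eq_sub_one]
      omega
    simp only [Polynomial.aeval_monomial, Polynomial.derivative_monomial]
    convert! h2 using 1
    · ext v
      simp [← Algebra.smul_def]
    · rw [map_sum, Finset.sum_congr rfl h3, Finset.sum_const, Finset.card_range, nsmul_eq_mul,
        ← Algebra.smul_def, smul_mul_assoc, map_smul, smul_eq_mul]
      ring

lemma spectrum_subset_Icc {A : Type*} [CStarAlgebra A] {a : A} (ha : IsSelfAdjoint a) {M : ℝ}
    (hM : ‖a‖ ≤ M) {x : ℝ} (hx : x ∈ spectrum ℝ a) : x ∈ Set.Icc (-M) M := by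
  have : ‖x‖ ≤ ‖a‖ := IsometricContinuousFunctionalCalculus.norm_spectrum_le a hx ha
  exact abs_le.1 (this.trans hM)

lemma realTrace_aeval_mono {τ : A →ₚ[ℂ] ℂ} (hτ : IsFaithfulTracialState τ) {S T : A}
    (hS : IsSelfAdjoint S) (hT : IsSelfAdjoint T) (hST : S ≤ T) (p : Polynomial ℝ)
    (hp : ∀ x ∈ Set.Icc (-(‖S‖ + ‖T - S‖)) (‖S‖ + ‖T - S‖), 0 ≤ (Polynomial.derivative p).eval x) :
    realTrace τ (Polynomial.aeval S p) ≤ realTrace τ (Polynomial.aeval T p) := by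
  have hd := fun u => hasDerivAt_realTrace_aeval hτ S (T - S) p u
  have hmono : MonotoneOn (fun u : ℝ => realTrace τ (Polynomial.aeval (S + u • (T - S)) p))
      (Set.Icc 0 1) := by
    refine monotoneOn_of_deriv_nonneg (convex_Icc 0 1)
      (fun u _ => (hd u).continuousAt.continuousWithinAt)
      (fun u _ => (hd u).differentiableAt.differentiableWithinAt) ?_
    intro u hu
    rw [interior_Icc] at hu
    rw [(hd u).deriv]
    have hX : IsSelfAdjoint (S + u • (T - S)) := hS.add (.smul (.all u) (hT.sub hS))
    refine hτ.realTrace_mul_nonneg ?_ (sub_nonneg.2 hST)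
    rw [← cfc_polynomial _ _ hX]
    refine cfc_nonneg fun x hx => hp x (spectrum_subset_Icc hX ?_ hx)
    refine (norm_add_le _ _).trans (add_le_add le_rfl ?_)
    rw [norm_smul, Real.norm_of_nonneg hu.1.le]
    exact mul_le_of_le_one_left (norm_nonneg _) hu.2.le
  simpa using hmono (Set.left_mem_Icc.2 zero_le_one) (Set.right_mem_Icc.2 zero_le_one) zero_le_one

lemma Polynomial.exists_derivative_eq (q : Polynomial ℝ) :
    ∃ p : Polynomial ℝ, Polynomial.derivative p = q := by
  induction q using Polynomial.induction_on' with
  | add p q hp hq =>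
    obtain ⟨p', rfl⟩ := hp
    obtain ⟨q', rfl⟩ := hq
    exact ⟨p' + q', Polynomial.derivative_add⟩
  | monomial n a =>
    refine ⟨Polynomial.monomial (n + 1) (a / (n + 1)), ?_⟩
    rw [Polynomial.derivative_monomial]
    push_cast
    rw [div_mul_cancel₀ _ (by positivity)]

/-- A `C¹` function with nonnegative derivative is, on a compact interval, uniformly close to
polynomials whose derivative is nonnegative there. -/
lemma exists_polynomial_near_of_deriv_nonneg {M η : ℝ} (hM : 0 ≤ M) (hη : 0 < η) {h : ℝ → ℝ}
    (hd : ContDiff ℝ 1 h) (hn : ∀ x, 0 ≤ deriv h x) :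
    ∃ p : Polynomial ℝ, (∀ x ∈ Set.Icc (-M) M, 0 ≤ (Polynomial.derivative p).eval x) ∧
      ∀ x ∈ Set.Icc (-M) M, |p.eval x - h x| ≤ η := by
  set c : ℝ := η / (2 * (2 * M + 1)) with hc
  have hc0 : 0 < c := by positivity
  obtain ⟨q, hq⟩ := exists_polynomial_near_of_continuousOn (-M) M (deriv h)
    (hd.continuous_deriv le_rfl).continuousOn c hc0
  obtain ⟨p, hp⟩ := Polynomial.exists_derivative_eq (q + Polynomial.C c)
  have hpe : ∀ x, (Polynomial.derivative p).eval x = q.eval x + c := by simp [hp]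
  refine ⟨p + Polynomial.C (h (-M) - p.eval (-M)), ?_, ?_⟩
  · intro x hx
    have h1 := abs_lt.1 (hq x hx)
    have h2 := hn x
    simp only [Polynomial.derivative_add, Polynomial.derivative_C, add_zero, hpe]
    linarith
  · intro x hx
    have hder : ∀ y ∈ Set.Icc (-M) M, HasDerivWithinAt (fun y => p.eval y - h y)
        (q.eval y + c - deriv h y) (Set.Icc (-M) M) y := by
      intro y _
      have h1 := p.hasDerivAt y
      rw [hpe] at h1
      exact (h1.sub (hd.differentiable one_ne_zero y).hasDerivAt).hasDerivWithinAt
    have hb : ∀ y ∈ Set.Icc (-M) M, ‖q.eval y + c - deriv h y‖ ≤ 2 * c := by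
      intro y hy
      have h1 := abs_lt.1 (hq y hy)
      rw [Real.norm_eq_abs, abs_le]
      constructor <;> linarith
    have key := (convex_Icc (-M) M).norm_image_sub_le_of_norm_hasDerivWithin_le hder hb
      (Set.left_mem_Icc.2 (by linarith)) hx
    rw [Real.norm_eq_abs, Real.norm_eq_abs] at key
    have e : (p + Polynomial.C (h (-M) - p.eval (-M))).eval x - h x
        = p.eval x - h x - (p.eval (-M) - h (-M)) := by simp; ring
    rw [e]
    refine key.trans ?_
    have h3 : |x - -M| ≤ 2 * M + 1 := by
      rw [abs_le]; constructor <;> linarith [hx.1, hx.2]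
    calc 2 * c * |x - -M| ≤ 2 * c * (2 * M + 1) := by gcongr
      _ = η := by rw [hc]; field_simp

/-- On self-adjoint elements, `a ↦ τ(h(a))` is monotone for nondecreasing `C¹` functions `h`, even
though `a ↦ h(a)` need not be. -/
lemma realTrace_cfc_mono {τ : A →ₚ[ℂ] ℂ} (hτ : IsFaithfulTracialState τ) {S T : A}
    (hS : IsSelfAdjoint S) (hT : IsSelfAdjoint T) (hST : S ≤ T) {h : ℝ → ℝ}
    (hd : ContDiff ℝ 1 h) (hn : ∀ x, 0 ≤ deriv h x) :
    realTrace τ (cfc h S) ≤ realTrace τ (cfc h T) := by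
  refine le_of_forall_pos_le_add fun η hη => ?_
  set M := ‖S‖ + ‖T - S‖
  obtain ⟨p, hp, hph⟩ := exists_polynomial_near_of_deriv_nonneg (M := M) (by positivity)
    (half_pos hη) hd hn
  have hcont : Continuous h := hd.continuous
  have hSM : ‖S‖ ≤ M := le_add_of_nonneg_right (norm_nonneg _)
  have hTM : ‖T‖ ≤ M := by simpa using norm_add_le S (T - S)
  have h1 : cfc h S ≤ cfc (fun x => p.eval x + η / 2) S :=
    cfc_mono (fun x hx => by linarith [(abs_le.1 (hph x (spectrum_subset_Icc hS hSM hx))).1])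
  have h2 : cfc p.eval T ≤ cfc (fun x => h x + η / 2) T :=
    cfc_mono (fun x hx => by linarith [(abs_le.1 (hph x (spectrum_subset_Icc hT hTM hx))).2])
  rw [cfc_add_const _ _ _, cfc_polynomial p S] at h1
  rw [cfc_add_const _ _ _, cfc_polynomial p T] at h2
  have h3 := realTrace_mono τ h1
  have h4 := realTrace_mono τ h2
  have h5 := realTrace_aeval_mono hτ hS hT hST p hp
  rw [map_add, hτ.realTrace_algebraMap] at h3 h4
  linarith

/-! ### The cutoff functions -/

lemma continuous_cutoffFun (ε : ℝ) : Continuous (cutoffFun ε) := by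
  unfold cutoffFun; fun_prop

lemma cutoffFun_nonneg (ε x : ℝ) : 0 ≤ cutoffFun ε x := le_max_left _ _

lemma cutoffFun_le_one (ε x : ℝ) : cutoffFun ε x ≤ 1 :=
  max_le zero_le_one (min_le_left _ _)

lemma cutoffFun_eq_zero {ε x : ℝ} (hε : 0 < ε) (hx : x ≤ ε / 2) : cutoffFun ε x = 0 := by
  refine max_eq_left ((min_le_right _ _).trans ?_)
  rw [sub_nonpos, div_le_one hε]
  linarith

lemma cutoffFun_eq_one {ε x : ℝ} (hε : 0 < ε) (hx : ε ≤ x) : cutoffFun ε x = 1 := by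
  have : 1 ≤ 2 * x / ε - 1 := by
    rw [le_sub_iff_add_le, le_div_iff₀ hε]
    linarith
  rw [cutoffFun, min_eq_left this, max_eq_right zero_le_one]

lemma cutoffFun_mono {ε : ℝ} (hε : 0 < ε) : Monotone (cutoffFun ε) := by
  intro x y h
  unfold cutoffFun
  gcongr

lemma cutoffFun_anti {ε δ : ℝ} (hε : 0 < ε) (h : ε ≤ δ) (x : ℝ) :
    cutoffFun δ x ≤ cutoffFun ε x := by
  rcases le_total x 0 with hx | hx
  · rw [cutoffFun_eq_zero (hε.trans_le h) (by linarith)]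
    exact cutoffFun_nonneg _ _
  · unfold cutoffFun
    gcongr

lemma cutoffFun_max_zero {ε : ℝ} (hε : 0 < ε) (x : ℝ) :
    cutoffFun ε (max x 0) = cutoffFun ε x := by
  rcases le_total x 0 with hx | hx
  · rw [max_eq_right hx, cutoffFun_eq_zero hε (by linarith), cutoffFun_eq_zero hε (by linarith)]
  · rw [max_eq_left hx]

lemma cfc_cutoffFun_posPart {A : Type*} [CStarAlgebra A] {T : A} (hT : IsSelfAdjoint T) {ε : ℝ}
    (hε : 0 < ε) (t : ℝ) :
    cfc (cutoffFun ε) ((T - algebraMap ℝ A t)⁺) = cfc (fun x => cutoffFun ε (x - t)) T := by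
  have h1 : T - algebraMap ℝ A t = cfc (fun x : ℝ => x - t) T := by
    rw [cfc_sub (fun x : ℝ => x) (fun _ => t) T, cfc_id' ℝ T, cfc_const t T]
  have h2 : (T - algebraMap ℝ A t)⁺ = cfc (fun x : ℝ => max (x - t) 0) T := by
    rw [CFC.posPart_def, cfcₙ_eq_cfc, h1, ← cfc_comp' (fun x : ℝ => x⁺) (fun x => x - t) T]
    rfl
  rw [h2, ← cfc_comp' (cutoffFun ε) (fun x : ℝ => max (x - t) 0) T
    (continuous_cutoffFun ε).continuousOn]
  simp_rw [cutoffFun_max_zero hε]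

/-! ### The trace of the spectral part above a level -/

/-- `d_τ((T - t)₊)`: the trace of the "spectral projection" of `T` for the interval `(t, ∞)`. -/
def upperMass (τ : A →ₚ[ℂ] ℂ) (T : A) (t : ℝ) : ℝ := dimFun τ ((T - algebraMap ℝ A t)⁺)

lemma continuousOn_cutoffFun_sub (ε t : ℝ) (s : Set ℝ) :
    ContinuousOn (fun x => cutoffFun ε (x - t)) s :=
  ((continuous_cutoffFun ε).comp (continuous_id.sub continuous_const)).continuousOn

lemma realTrace_cfc_le_one {τ : A →ₚ[ℂ] ℂ} (hτ : IsFaithfulTracialState τ) {T : A} {f : ℝ → ℝ}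
    (hf : ∀ x, f x ≤ 1) : realTrace τ (cfc f T) ≤ 1 := by
  rw [← hτ.realTrace_one]
  exact realTrace_mono τ (cfc_le_one f T fun x _ => hf x)

lemma realTrace_cfc_le_realTrace_cfc (τ : A →ₚ[ℂ] ℂ) {T : A} {f g : ℝ → ℝ}
    (hf : ContinuousOn f (spectrum ℝ T)) (hg : ContinuousOn g (spectrum ℝ T))
    (h : ∀ x ∈ spectrum ℝ T, f x ≤ g x) : realTrace τ (cfc f T) ≤ realTrace τ (cfc g T) :=
  realTrace_mono τ (cfc_mono h hf hg)

lemma tendsto_upperMass {τ : A →ₚ[ℂ] ℂ} (hτ : IsFaithfulTracialState τ) {T : A}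
    (hT : IsSelfAdjoint T) (t : ℝ) :
    Tendsto (fun ε => realTrace τ (cfc (fun x => cutoffFun ε (x - t)) T)) (𝓝[>] 0)
      (𝓝 (upperMass τ T t)) := by
  have hanti : AntitoneOn (fun ε => realTrace τ (cfc (fun x => cutoffFun ε (x - t)) T))
      (Set.Ioi 0) := fun ε hε δ _ h =>
    realTrace_cfc_le_realTrace_cfc τ (continuousOn_cutoffFun_sub _ _ _)
      (continuousOn_cutoffFun_sub _ _ _) fun x _ => cutoffFun_anti hε h _
  have hbdd : BddAbove ((fun ε => realTrace τ (cfc (fun x => cutoffFun ε (x - t)) T)) ''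
      Set.Ioi 0) := by
    refine ⟨1, ?_⟩
    rintro _ ⟨ε, _, rfl⟩
    exact realTrace_cfc_le_one hτ fun x => cutoffFun_le_one _ _
  have h1 := hanti.tendsto_nhdsGT hbdd
  have h2 : Tendsto (fun ε => (τ (cfc (cutoffFun ε) ((T - algebraMap ℝ A t)⁺))).re) (𝓝[>] 0)
      (𝓝 _) := h1.congr' <| by
    filter_upwards [self_mem_nhdsWithin] with ε hε
    rw [cfc_cutoffFun_posPart hT hε, realTrace_apply]
  have h3 := h2.limUnder_eq
  rw [upperMass, dimFun, h3]
  exact h1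

lemma realTrace_cfc_cutoffFun_le_upperMass {τ : A →ₚ[ℂ] ℂ} (hτ : IsFaithfulTracialState τ) {T : A}
    (hT : IsSelfAdjoint T) (t : ℝ) {ε : ℝ} (hε : 0 < ε) :
    realTrace τ (cfc (fun x => cutoffFun ε (x - t)) T) ≤ upperMass τ T t := by
  refine ge_of_tendsto (tendsto_upperMass hτ hT t) ?_
  filter_upwards [Ioo_mem_nhdsGT hε] with δ hδ
  exact realTrace_cfc_le_realTrace_cfc τ (continuousOn_cutoffFun_sub _ _ _)
    (continuousOn_cutoffFun_sub _ _ _) fun x _ => cutoffFun_anti hδ.1 hδ.2.le _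

lemma upperMass_le {τ : A →ₚ[ℂ] ℂ} (hτ : IsFaithfulTracialState τ) {T : A}
    (hT : IsSelfAdjoint T) {t c : ℝ}
    (h : ∀ ε > 0, realTrace τ (cfc (fun x => cutoffFun ε (x - t)) T) ≤ c) :
    upperMass τ T t ≤ c := by
  refine le_of_tendsto (tendsto_upperMass hτ hT t) ?_
  filter_upwards [self_mem_nhdsWithin] with ε hε using h ε hε

lemma upperMass_le_one {τ : A →ₚ[ℂ] ℂ} (hτ : IsFaithfulTracialState τ) {T : A}
    (hT : IsSelfAdjoint T) (t : ℝ) : upperMass τ T t ≤ 1 :=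
  upperMass_le hτ hT fun _ _ => realTrace_cfc_le_one hτ fun _ => cutoffFun_le_one _ _

lemma upperMass_nonneg {τ : A →ₚ[ℂ] ℂ} (hτ : IsFaithfulTracialState τ) {T : A}
    (hT : IsSelfAdjoint T) (t : ℝ) : 0 ≤ upperMass τ T t :=
  (realTrace_nonneg τ (cfc_nonneg fun _ _ => cutoffFun_nonneg _ _)).trans
    (realTrace_cfc_cutoffFun_le_upperMass hτ hT t one_pos)

lemma upperMass_antitone {τ : A →ₚ[ℂ] ℂ} (hτ : IsFaithfulTracialState τ) {T : A}
    (hT : IsSelfAdjoint T) : Antitone (upperMass τ T) := fun _ t h =>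
  upperMass_le hτ hT fun _ hε => le_trans
    (realTrace_cfc_le_realTrace_cfc τ (continuousOn_cutoffFun_sub _ _ _)
      (continuousOn_cutoffFun_sub _ _ _) fun _ _ => cutoffFun_mono hε (by linarith))
    (realTrace_cfc_cutoffFun_le_upperMass hτ hT _ hε)

/-- Right-continuity of `t ↦ d_τ((T - t)₊)`. -/
lemma upperMass_le_of_forall_gt {τ : A →ₚ[ℂ] ℂ} (hτ : IsFaithfulTracialState τ) {T : A}
    (hT : IsSelfAdjoint T) {t c : ℝ} (h : ∀ t' > t, upperMass τ T t' ≤ c) :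
    upperMass τ T t ≤ c := by
  refine upperMass_le hτ hT fun ε hε => ?_
  refine le_trans ?_ (h (t + ε / 4) (by linarith))
  refine le_trans ?_ (realTrace_cfc_cutoffFun_le_upperMass hτ hT (t + ε / 4)
    (ε := ε / 4) (by positivity))
  refine realTrace_cfc_le_realTrace_cfc τ (continuousOn_cutoffFun_sub _ _ _)
      (continuousOn_cutoffFun_sub _ _ _) fun x _ => ?_
  rcases le_total (x - t) (ε / 2) with hx | hx
  · rw [cutoffFun_eq_zero hε hx]
    exact cutoffFun_nonneg _ _
  · rw [cutoffFun_eq_one (ε := ε / 4) (by positivity) (by linarith)]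
    exact cutoffFun_le_one _ _

lemma upperMass_of_norm_le {τ : A →ₚ[ℂ] ℂ} (hτ : IsFaithfulTracialState τ) {T : A}
    (hT : IsSelfAdjoint T) {t : ℝ} (ht : ‖T‖ ≤ t) : upperMass τ T t = 0 := by
  refine le_antisymm (upperMass_le hτ hT fun ε hε => ?_) (upperMass_nonneg hτ hT t)
  have h : cfc (fun x => cutoffFun ε (x - t)) T ≤ 0 := cfc_nonpos _ _ fun x hx => by
    have := (spectrum_subset_Icc hT ht hx).2
    rw [cutoffFun_eq_zero hε (by linarith)]
  simpa using realTrace_mono τ h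

lemma upperMass_of_lt_neg_norm {τ : A →ₚ[ℂ] ℂ} (hτ : IsFaithfulTracialState τ) {T : A}
    (hT : IsSelfAdjoint T) {t : ℝ} (ht : t < -‖T‖) : upperMass τ T t = 1 := by
  refine le_antisymm (upperMass_le_one hτ hT t) ?_
  have hε : 0 < -‖T‖ - t := by linarith
  refine le_trans ?_ (realTrace_cfc_cutoffFun_le_upperMass hτ hT t hε)
  rw [← hτ.realTrace_one]
  refine realTrace_mono τ (one_le_cfc _ _ (fun x hx => ?_) (continuousOn_cutoffFun_sub _ _ _))
  have := (spectrum_subset_Icc hT le_rfl hx).1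
  rw [cutoffFun_eq_one hε (by linarith)]

lemma upperMass_mono_left {τ : A →ₚ[ℂ] ℂ} (hτ : IsFaithfulTracialState τ) {S T : A}
    (hS : IsSelfAdjoint S) (hT : IsSelfAdjoint T) (h : S ≤ T) (t : ℝ) :
    upperMass τ S t ≤ upperMass τ T t := by
  refine upperMass_le hτ hS fun ε hε => ?_
  -- a smooth step squeezed between two cutoff functions, to which `realTrace_cfc_mono` applies
  set g : ℝ → ℝ := fun x => Real.smoothTransition ((x - t - ε / 4) * (4 / ε)) with hg
  have hgd : ContDiff ℝ 1 g :=
    Real.smoothTransition.contDiff.comp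
      (((contDiff_id.sub contDiff_const).sub contDiff_const).mul contDiff_const)
  have hgm : Monotone g := fun x y hxy => Real.smoothTransition.monotone
    (mul_le_mul_of_nonneg_right (by linarith) (by positivity))
  refine le_trans ?_ ((realTrace_cfc_mono hτ hS hT h hgd fun x => hgm.deriv_nonneg).trans ?_)
  · refine realTrace_cfc_le_realTrace_cfc τ (continuousOn_cutoffFun_sub _ _ _)
      hgd.continuous.continuousOn fun x _ => ?_
    rcases le_total (x - t) (ε / 2) with hx | hx
    · rw [cutoffFun_eq_zero hε hx]
      exact Real.smoothTransition.nonneg _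
    · rw [hg]
      dsimp only
      rw [Real.smoothTransition.one_of_one_le]
      · exact cutoffFun_le_one _ _
      · rw [mul_div_assoc', le_div_iff₀ hε]
        linarith
  · refine le_trans ?_ (realTrace_cfc_cutoffFun_le_upperMass hτ hT t (ε := ε / 4) (by positivity))
    refine realTrace_cfc_le_realTrace_cfc τ hgd.continuous.continuousOn
      (continuousOn_cutoffFun_sub _ _ _) fun x _ => ?_
    rcases le_total (x - t) (ε / 4) with hx | hx
    · rw [hg]
      dsimp only
      rw [Real.smoothTransition.zero_of_nonpos]
      · exact cutoffFun_nonneg _ _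
      · exact mul_nonpos_of_nonpos_of_nonneg (by linarith) (by positivity)
    · rw [cutoffFun_eq_one (by positivity) hx]
      exact Real.smoothTransition.le_one _

lemma upperMass_add_algebraMap {A : Type*} [CStarAlgebra A] [PartialOrder A] (τ : A →ₚ[ℂ] ℂ)
    (T : A) (t r : ℝ) :
    upperMass τ (T + algebraMap ℝ A r) (t + r) = upperMass τ T t := by
  rw [upperMass, upperMass, map_add, add_sub_add_right_eq_sub]

lemma upperMass_conj_unitary {τ : A →ₚ[ℂ] ℂ} (hτ : IsFaithfulTracialState τ) {T U : A}
    (hT : IsSelfAdjoint T) (hU : U ∈ unitary A) (t : ℝ) :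
    upperMass τ (star U * T * U) t = upperMass τ T t := by
  have hT' : IsSelfAdjoint (star U * T * U) := by
    simpa using hT.conjugate (star U)
  have h : ∀ ε, realTrace τ (cfc (fun x => cutoffFun ε (x - t)) (star U * T * U))
      = realTrace τ (cfc (fun x => cutoffFun ε (x - t)) T) := by
    intro ε
    let φ := Unitary.conjStarAlgAut ℝ A (star ⟨U, hU⟩)
    have hφ : ∀ x, φ x = star U * x * U := fun x => Unitary.conjStarAlgAut_star_apply _ x
    have hc : Continuous φ := by
      have : (φ : A → A) = fun x => star U * x * U := funext hφ
      rw [this]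
      fun_prop
    have h1 := StarAlgHomClass.map_cfc (S := ℝ) φ (fun x => cutoffFun ε (x - t)) T
      (continuousOn_cutoffFun_sub _ _ _) hc hT (by rw [hφ]; exact hT')
    rw [hφ, hφ] at h1
    rw [← h1, hτ.realTrace_mul_comm, ← mul_assoc, Unitary.mul_star_self_of_mem hU, one_mul]
  exact tendsto_nhds_unique ((tendsto_upperMass hτ hT' t).congr h) (tendsto_upperMass hτ hT t)

/-! ### Spectral projections at gaps of the spectrum -/

/-- The indicator function of `(t, ∞)`. -/
def stepFun (t x : ℝ) : ℝ := if t < x then 1 else 0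

lemma continuousOn_stepFun {t : ℝ} {s : Set ℝ} (ht : t ∉ s) : ContinuousOn (stepFun t) s := by
  intro x hx
  have hne : x ≠ t := fun h => ht (h ▸ hx)
  refine ContinuousAt.continuousWithinAt ?_
  rcases lt_or_gt_of_ne hne with h | h
  · refine (continuousAt_const (y := (0 : ℝ))).congr ?_
    filter_upwards [Iio_mem_nhds h] with y hy
    exact (if_neg (not_lt.2 (le_of_lt hy))).symm
  · refine (continuousAt_const (y := (1 : ℝ))).congr ?_
    filter_upwards [Ioi_mem_nhds h] with y hy
    exact (if_pos hy).symm

lemma stepFun_mul_of_le {s t : ℝ} (h : s ≤ t) (x : ℝ) :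
    stepFun s x * stepFun t x = stepFun t x := by
  unfold stepFun
  split_ifs <;> first | (exfalso; linarith) | simp

lemma isStarProjection_cfc_stepFun {A : Type*} [CStarAlgebra A] {T : A} {t : ℝ}
    (ht : t ∉ spectrum ℝ T) :
    IsStarProjection (cfc (stepFun t) T) := by
  have hc := continuousOn_stepFun ht
  refine ⟨?_, cfc_predicate _ _⟩
  rw [IsIdempotentElem, ← cfc_mul _ _ _ hc hc]
  simp_rw [stepFun_mul_of_le le_rfl]

lemma cfc_stepFun_anti {T : A} {s t : ℝ} (hs : s ∉ spectrum ℝ T) (ht : t ∉ spectrum ℝ T)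
    (h : s ≤ t) : cfc (stepFun t) T ≤ cfc (stepFun s) T := by
  refine cfc_mono (fun x _ => ?_) (continuousOn_stepFun ht) (continuousOn_stepFun hs)
  unfold stepFun
  split_ifs <;> first | (exfalso; linarith) | simp

lemma upperMass_of_notMem_spectrum {τ : A →ₚ[ℂ] ℂ} (hτ : IsFaithfulTracialState τ) {T : A}
    (hT : IsSelfAdjoint T) {t : ℝ} (ht : t ∉ spectrum ℝ T) :
    upperMass τ T t = realTrace τ (cfc (stepFun t) T) := by
  have hc := continuousOn_stepFun ht
  refine le_antisymm (upperMass_le hτ hT fun ε hε => ?_) ?_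
  · refine realTrace_cfc_le_realTrace_cfc τ (continuousOn_cutoffFun_sub _ _ _) hc fun x _ => ?_
    unfold stepFun
    split_ifs with hx
    · exact cutoffFun_le_one _ _
    · exact (cutoffFun_eq_zero hε (by linarith)).le
  · obtain ⟨d, hd, hball⟩ := Metric.isOpen_iff.1
      (ContinuousFunctionalCalculus.isCompact_spectrum (R := ℝ) T).isClosed.isOpen_compl t ht
    refine le_trans ?_ (realTrace_cfc_cutoffFun_le_upperMass hτ hT t hd)
    refine realTrace_cfc_le_realTrace_cfc τ hc (continuousOn_cutoffFun_sub _ _ _) fun x hx => ?_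
    unfold stepFun
    split_ifs with htx
    · rw [cutoffFun_eq_one hd]
      by_contra! hlt
      have hmem : x ∈ Metric.ball t d := by
        rw [Metric.mem_ball, Real.dist_eq, abs_lt]
        constructor <;> linarith
      exact hball hmem hx
    · exact cutoffFun_nonneg _ _

/-! ### The eigenvalue function -/

lemma eigenvalueFun_eq {A : Type*} [CStarAlgebra A] [PartialOrder A] (τ : A →ₚ[ℂ] ℂ) (T : A)
    (s : ℝ) :
    eigenvalueFun τ T s = sInf {t : ℝ | upperMass τ T t ≤ s} := rfl

/-- The eigenvalue function is the generalized inverse of `t ↦ d_τ((T - t)₊)`. -/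
lemma eigenvalueFun_le_iff {τ : A →ₚ[ℂ] ℂ} (hτ : IsFaithfulTracialState τ) {T : A}
    (hT : IsSelfAdjoint T) {s t : ℝ} (hs : s ∈ Set.Ico (0 : ℝ) 1) :
    eigenvalueFun τ T s ≤ t ↔ upperMass τ T t ≤ s := by
  rw [eigenvalueFun_eq]
  have hne : {t : ℝ | upperMass τ T t ≤ s}.Nonempty :=
    ⟨‖T‖, by simpa [upperMass_of_norm_le hτ hT le_rfl] using hs.1⟩
  have hbdd : BddBelow {t : ℝ | upperMass τ T t ≤ s} := by
    refine ⟨-‖T‖, fun t ht => ?_⟩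
    by_contra! hlt
    have h1 : upperMass τ T t ≤ s := ht
    rw [upperMass_of_lt_neg_norm hτ hT hlt] at h1
    linarith [hs.2]
  constructor
  · intro h
    refine upperMass_le_of_forall_gt hτ hT fun t' ht' => ?_
    obtain ⟨u, hu, hut⟩ := exists_lt_of_csInf_lt hne (h.trans_lt ht')
    exact (upperMass_antitone hτ hT hut.le).trans hu
  · exact fun h => csInf_le hbdd h

lemma lt_eigenvalueFun_iff {τ : A →ₚ[ℂ] ℂ} (hτ : IsFaithfulTracialState τ) {T : A}
    (hT : IsSelfAdjoint T) {s t : ℝ} (hs : s ∈ Set.Ico (0 : ℝ) 1) :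
    t < eigenvalueFun τ T s ↔ s < upperMass τ T t := by
  rw [← not_le, ← not_le, eigenvalueFun_le_iff hτ hT hs]

lemma eigenvalueFun_antitoneOn {τ : A →ₚ[ℂ] ℂ} (hτ : IsFaithfulTracialState τ) {T : A}
    (hT : IsSelfAdjoint T) : AntitoneOn (eigenvalueFun τ T) (Set.Ico 0 1) := by
  intro s hs s' hs' h
  rw [eigenvalueFun_le_iff hτ hT hs']
  exact ((eigenvalueFun_le_iff hτ hT hs).1 le_rfl).trans h

lemma eigenvalueFun_conj_unitary {τ : A →ₚ[ℂ] ℂ} (hτ : IsFaithfulTracialState τ) {T U : A}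
    (hT : IsSelfAdjoint T) (hU : U ∈ unitary A) (s : ℝ) :
    eigenvalueFun τ (star U * T * U) s = eigenvalueFun τ T s := by
  simp_rw [eigenvalueFun_eq, upperMass_conj_unitary hτ hT hU]

lemma eigenvalueFun_le_add {τ : A →ₚ[ℂ] ℂ} (hτ : IsFaithfulTracialState τ) {S T : A}
    (hS : IsSelfAdjoint S) (hT : IsSelfAdjoint T) {s : ℝ} (hs : s ∈ Set.Ico (0 : ℝ) 1) :
    eigenvalueFun τ S s ≤ eigenvalueFun τ T s + ‖S - T‖ := by
  rw [eigenvalueFun_le_iff hτ hS hs]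
  have h1 : S ≤ T + algebraMap ℝ A ‖S - T‖ :=
    sub_le_iff_le_add'.1 (hS.sub hT).le_algebraMap_norm_self
  refine (upperMass_mono_left hτ hS (hT.add (.algebraMap A (.all _))) h1 _).trans ?_
  rw [upperMass_add_algebraMap]
  exact (eigenvalueFun_le_iff hτ hT hs).1 le_rfl

lemma abs_eigenvalueFun_sub_le {τ : A →ₚ[ℂ] ℂ} (hτ : IsFaithfulTracialState τ) {S T : A}
    (hS : IsSelfAdjoint S) (hT : IsSelfAdjoint T) {s : ℝ} (hs : s ∈ Set.Ico (0 : ℝ) 1) :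
    |eigenvalueFun τ S s - eigenvalueFun τ T s| ≤ ‖S - T‖ := by
  have h1 := eigenvalueFun_le_add hτ hS hT hs
  have h2 := eigenvalueFun_le_add hτ hT hS hs
  rw [norm_sub_rev] at h2
  rw [abs_le]
  constructor <;> linarith

/-! ### Rearrangement and majorization -/

/-- The eigenvalue function is its own non-increasing rearrangement. -/
lemma decreasingRearrangement_eigenvalueFun {τ : A →ₚ[ℂ] ℂ} (hτ : IsFaithfulTracialState τ) {T : A}
    (hT : IsSelfAdjoint T) {s : ℝ} (hs : 0 ≤ s) :
    decreasingRearrangement (eigenvalueFun τ T) s = eigenvalueFun τ T s := by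
  have hvol : ∀ t, MeasureTheory.volume {x ∈ Set.Icc (0 : ℝ) 1 | t < eigenvalueFun τ T x}
      = ENNReal.ofReal (upperMass τ T t) := by
    intro t
    have hsub : Set.Ico 0 (upperMass τ T t) ⊆
        {x ∈ Set.Icc (0 : ℝ) 1 | t < eigenvalueFun τ T x} := by
      intro x hx
      have hx1 : x < 1 := hx.2.trans_le (upperMass_le_one hτ hT t)
      exact ⟨⟨hx.1, hx1.le⟩, (lt_eigenvalueFun_iff hτ hT ⟨hx.1, hx1⟩).2 hx.2⟩
    -- `eigenvalueFun τ T 1` carries no information, so the point `1` is treated separately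
    have hsup : {x ∈ Set.Icc (0 : ℝ) 1 | t < eigenvalueFun τ T x} ⊆
        Set.Ico 0 (upperMass τ T t) ∪ {1} := by
      rintro x ⟨⟨hx0, hx1⟩, hx⟩
      rcases hx1.lt_or_eq with h | h
      · exact Or.inl ⟨hx0, (lt_eigenvalueFun_iff hτ hT ⟨hx0, h⟩).1 hx⟩
      · exact Or.inr h
    refine le_antisymm ?_ ?_
    · refine (MeasureTheory.measure_mono hsup).trans
        ((MeasureTheory.measure_union_le _ _).trans ?_)
      simp
    · simpa using MeasureTheory.measure_mono (μ := MeasureTheory.volume) hsub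
  rw [decreasingRearrangement, eigenvalueFun_eq]
  simp_rw [hvol, ENNReal.ofReal_le_ofReal_iff hs]

lemma integral_decreasingRearrangement_eigenvalueFun {τ : A →ₚ[ℂ] ℂ}
    (hτ : IsFaithfulTracialState τ) {T : A} (hT : IsSelfAdjoint T) {t : ℝ} (ht : 0 ≤ t) :
    ∫ s in (0 : ℝ)..t, decreasingRearrangement (eigenvalueFun τ T) s
      = ∫ s in (0 : ℝ)..t, eigenvalueFun τ T s := by
  refine intervalIntegral.integral_congr fun s hs => ?_
  rw [Set.uIcc_of_le ht] at hs
  exact decreasingRearrangement_eigenvalueFun hτ hT hs.1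

lemma eigenvalueFun_le_of_integral_eq {τ : A →ₚ[ℂ] ℂ} (hτ : IsFaithfulTracialState τ) {S T : A}
    (hS : IsSelfAdjoint S) (hT : IsSelfAdjoint T)
    (h : ∀ t ∈ Set.Icc (0 : ℝ) 1,
      ∫ s in (0 : ℝ)..t, eigenvalueFun τ S s = ∫ s in (0 : ℝ)..t, eigenvalueFun τ T s)
    {s : ℝ} (hs : s ∈ Set.Ico (0 : ℝ) 1) : eigenvalueFun τ T s ≤ eigenvalueFun τ S s := by
  by_contra! hlt
  obtain ⟨c, hc1, hc2⟩ := exists_between hlt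
  -- by right-continuity, `c` keeps the two functions apart on an interval `[s, u]`
  obtain ⟨c', hc1', hc2'⟩ := exists_between hc2
  obtain ⟨u, hu1, hu2⟩ := exists_between ((lt_eigenvalueFun_iff hτ hT hs).1 hc2')
  have hu3 : u < 1 := hu2.trans_le (upperMass_le_one hτ hT c')
  have hsub : Set.uIcc 0 u ⊆ Set.Ico 0 1 := by
    rw [Set.uIcc_of_le (hs.1.trans hu1.le)]
    exact fun x hx => ⟨hx.1, hx.2.trans_lt hu3⟩
  have hint : ∀ {R : A}, IsSelfAdjoint R →
      IntervalIntegrable (eigenvalueFun τ R) MeasureTheory.volume 0 u := fun hR =>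
    ((eigenvalueFun_antitoneOn hτ hR).mono hsub).intervalIntegrable
  have hmem : ∀ x ∈ Set.uIcc 0 u, x ∈ Set.Ico (0 : ℝ) 1 := fun x hx => hsub hx
  have hs_mem : s ∈ Set.uIcc 0 u := by
    rw [Set.uIcc_of_le (hs.1.trans hu1.le)]; exact ⟨hs.1, hu1.le⟩
  have hint1 : ∀ {R : A}, IsSelfAdjoint R →
      IntervalIntegrable (eigenvalueFun τ R) MeasureTheory.volume 0 s := fun hR =>
    (hint hR).mono_set (Set.uIcc_subset_uIcc_left hs_mem)
  have hint2 : ∀ {R : A}, IsSelfAdjoint R →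
      IntervalIntegrable (eigenvalueFun τ R) MeasureTheory.volume s u := fun hR =>
    (hint hR).mono_set (Set.uIcc_subset_uIcc_right hs_mem)
  have e1 := h u ⟨hs.1.trans hu1.le, hu3.le⟩
  have e2 := h s ⟨hs.1, hs.2.le⟩
  rw [← intervalIntegral.integral_add_adjacent_intervals (hint1 hS) (hint2 hS),
    ← intervalIntegral.integral_add_adjacent_intervals (hint1 hT) (hint2 hT), e2] at e1
  have e3 : ∫ x in s..u, eigenvalueFun τ S x ≤ ∫ _ in s..u, c := by
    refine intervalIntegral.integral_mono_on hu1.le (hint2 hS) intervalIntegrable_const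
      fun x hx => ?_
    exact (eigenvalueFun_antitoneOn hτ hS hs ⟨hs.1.trans hx.1, hx.2.trans_lt hu3⟩ hx.1).trans hc1.le
  have e4 : ∫ _ in s..u, c' ≤ ∫ x in s..u, eigenvalueFun τ T x := by
    refine intervalIntegral.integral_mono_on hu1.le intervalIntegrable_const (hint2 hT)
      fun x hx => ?_
    exact ((lt_eigenvalueFun_iff hτ hT ⟨hs.1.trans hx.1, hx.2.trans_lt hu3⟩).2
      (hx.2.trans_lt hu2)).le
  rw [intervalIntegral.integral_const, smul_eq_mul] at e3 e4
  have : (u - s) * c < (u - s) * c' := mul_lt_mul_of_pos_left hc1' (sub_pos.2 hu1)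
  linarith

lemma traceMajorizes_antisymm_iff {τ : A →ₚ[ℂ] ℂ} (hτ : IsFaithfulTracialState τ) {S T : A}
    (hS : IsSelfAdjoint S) (hT : IsSelfAdjoint T) :
    (∀ s ∈ Set.Ico (0 : ℝ) 1, eigenvalueFun τ S s = eigenvalueFun τ T s) ↔
      TraceMajorizes τ T S ∧ TraceMajorizes τ S T := by
  have hI := fun {R : A} (hR : IsSelfAdjoint R) {t : ℝ} =>
    integral_decreasingRearrangement_eigenvalueFun hτ hR (t := t)
  constructor
  · intro h
    have heq : ∀ t ∈ Set.Icc (0 : ℝ) 1,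
        ∫ s in (0 : ℝ)..t, decreasingRearrangement (eigenvalueFun τ S) s
          = ∫ s in (0 : ℝ)..t, decreasingRearrangement (eigenvalueFun τ T) s := by
      intro t ht
      rw [hI hS ht.1, hI hT ht.1]
      refine intervalIntegral.integral_congr_ae ?_
      filter_upwards [MeasureTheory.Measure.ae_ne MeasureTheory.volume (1 : ℝ)] with x hx1 hx
      rw [Set.uIoc_of_le ht.1] at hx
      exact h x ⟨hx.1.le, lt_of_le_of_ne (hx.2.trans ht.2) hx1⟩
    have h1 : (1 : ℝ) ∈ Set.Icc (0 : ℝ) 1 := Set.right_mem_Icc.2 zero_le_one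
    exact ⟨⟨fun t ht => (heq t ht).le, heq 1 h1⟩, ⟨fun t ht => (heq t ht).ge, (heq 1 h1).symm⟩⟩
  · rintro ⟨⟨h1, _⟩, ⟨h2, _⟩⟩
    have heq : ∀ t ∈ Set.Icc (0 : ℝ) 1,
        ∫ s in (0 : ℝ)..t, eigenvalueFun τ S s = ∫ s in (0 : ℝ)..t, eigenvalueFun τ T s := by
      intro t ht
      rw [← hI hS ht.1, ← hI hT ht.1]
      exact le_antisymm (h1 t ht) (h2 t ht)
    exact fun s hs => le_antisymm
      (eigenvalueFun_le_of_integral_eq hτ hT hS (fun t ht => (heq t ht).symm) hs)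
      (eigenvalueFun_le_of_integral_eq hτ hS hT heq hs)

/-! ### Opening gaps in the spectrum -/

/-- In real rank zero, finitely many prescribed points can be removed from the spectrum of a
self-adjoint element by an arbitrarily small self-adjoint perturbation: each condition is open and
dense. -/
lemma HasRealRankZero.exists_mem_forall_notMem_spectrum {A : Type*} [CStarAlgebra A]
    (hA : HasRealRankZero A) (F : Finset ℝ) {S : A} (hS : IsSelfAdjoint S) {O : Set A}
    (hO : IsOpen O) (hSO : S ∈ O) :
    ∃ b ∈ O, IsSelfAdjoint b ∧ ∀ t ∈ F, t ∉ spectrum ℝ b := by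
  induction F using Finset.induction_on with
  | empty => exact ⟨S, hSO, hS, by simp⟩
  | insert t F _ ih =>
    obtain ⟨b, hbO, hb, hbF⟩ := ih
    have hopen : IsOpen (O ∩ ⋂ t' ∈ F, {x : A | IsUnit (algebraMap ℝ A t' - x)}) := by
      refine hO.inter (isOpen_biInter_finset fun t' _ => ?_)
      exact Units.isOpen.preimage (continuous_const.sub continuous_id)
    have hpre := hopen.preimage (show Continuous fun x : A => x + algebraMap ℝ A t by fun_prop)
    have hsa : IsSelfAdjoint (b - algebraMap ℝ A t) := hb.sub (.algebraMap A (.all _))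
    obtain ⟨c, hcO, hc, hcu⟩ := mem_closure_iff.1 (hA _ hsa) _ hpre <| by
      simp only [Set.mem_preimage, sub_add_cancel]
      exact ⟨hbO, Set.mem_iInter₂.2 fun t' ht' => spectrum.notMem_iff.1 (hbF t' ht')⟩
    refine ⟨c + algebraMap ℝ A t, hcO.1, hc.add (.algebraMap A (.all _)), fun t' ht' => ?_⟩
    rw [spectrum.notMem_iff]
    rcases Finset.mem_insert.1 ht' with rfl | h
    · simpa using hcu.neg
    · exact Set.mem_iInter₂.1 hcO.2 t' h

/-! ### Weighted decompositions of a projection -/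

/-- The self-adjoint element `∑ c • p` of a list of weighted projections `(c, p)`. -/
def weightedSum {A : Type*} [CStarAlgebra A] : List (ℝ × A) → A
  | [] => 0
  | (c, p) :: L => c • p + weightedSum L

/-- The projections of the list are mutually orthogonal with sum `P`; encoded by splitting off
the subprojections of `P` one at a time. -/
def IsDecomposition : A → List (ℝ × A) → Prop
  | P, [] => P = 0
  | P, (_, p) :: L => IsStarProjection p ∧ p ≤ P ∧ IsDecomposition (P - p) L

/-- The step function on `[0, ∞)` taking the weights of the list, in their order, as values on
consecutive intervals whose lengths are the traces of the projections (and `0` afterwards). -/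
def stepValue (τ : A →ₚ[ℂ] ℂ) : List (ℝ × A) → ℝ → ℝ
  | [], _ => 0
  | (c, p) :: L, s => if s < realTrace τ p then c else stepValue τ L (s - realTrace τ p)

lemma isSelfAdjoint_weightedSum {A : Type*} [CStarAlgebra A] [PartialOrder A] {L : List (ℝ × A)}
    {P : A} (hL : IsDecomposition P L) :
    IsSelfAdjoint (weightedSum L) := by
  induction L generalizing P with
  | nil => exact .zero A
  | cons x L ih => exact .add (.smul (.all _) hL.1.isSelfAdjoint) (ih hL.2.2)

lemma mul_weightedSum {L : List (ℝ × A)} {P : A} (hP : IsStarProjection P)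
    (hL : IsDecomposition P L) : P * weightedSum L = weightedSum L := by
  induction L generalizing P with
  | nil => simp [weightedSum]
  | cons x L ih =>
    obtain ⟨c, p⟩ := x
    obtain ⟨hp, hpP, hL⟩ := hL
    have h1 := ih ((hp.le_iff_sub hP).1 hpP) hL
    have h2 := (hp.le_iff_mul_eq_right hP).1 hpP
    have h3 : P * (P - p) = P - p := by rw [mul_sub, hP.isIdempotentElem.eq, h2]
    rw [weightedSum, mul_add, mul_smul_comm, h2, ← h1, ← mul_assoc, h3]

lemma weightedSum_mul {L : List (ℝ × A)} {P : A} (hP : IsStarProjection P)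
    (hL : IsDecomposition P L) : weightedSum L * P = weightedSum L := by
  have h := congrArg star (mul_weightedSum hP hL)
  rwa [star_mul, hP.isSelfAdjoint.star_eq, (isSelfAdjoint_weightedSum hL).star_eq] at h

/-! ### Partial isometries -/

section PartialIsometry

variable {A : Type*} [CStarAlgebra A] {V V₁ V₂ p q p₁ p₂ q₁ q₂ : A}

lemma mul_of_star_mul_self_eq (hp : IsStarProjection p) (hV : star V * V = p) : V * p = V := by
  have h : star (V * p - V) * (V * p - V) = 0 := by
    have hi := hp.isIdempotentElem.eq
    rw [star_sub, star_mul, hp.isSelfAdjoint.star_eq]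
    calc (p * star V - star V) * (V * p - V)
        = p * (star V * V) * p - p * (star V * V) - (star V * V) * p + star V * V := by noncomm_ring
      _ = 0 := by rw [hV]; simp [hi]
  exact sub_eq_zero.1 ((CStarRing.star_mul_self_eq_zero_iff _).1 h)

lemma mul_of_mul_star_self_eq (hq : IsStarProjection q) (hV : V * star V = q) : q * V = V := by
  have h := congrArg star (mul_of_star_mul_self_eq (V := star V) hq (by rwa [star_star]))
  rwa [star_mul, star_star, hq.isSelfAdjoint.star_eq] at h

lemma star_mul_eq_zero_of_orthogonal (hq₁ : IsStarProjection q₁) (hq₂ : IsStarProjection q₂)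
    (h₁ : V₁ * star V₁ = q₁) (h₂ : V₂ * star V₂ = q₂) (h : q₁ * q₂ = 0) : star V₁ * V₂ = 0 := by
  rw [← mul_of_mul_star_self_eq hq₁ h₁, ← mul_of_mul_star_self_eq hq₂ h₂, star_mul,
    hq₁.isSelfAdjoint.star_eq, mul_assoc, ← mul_assoc q₁, h, zero_mul, mul_zero]

lemma mul_star_eq_zero_of_orthogonal (hp₁ : IsStarProjection p₁) (hp₂ : IsStarProjection p₂)
    (h₁ : star V₁ * V₁ = p₁) (h₂ : star V₂ * V₂ = p₂) (h : p₁ * p₂ = 0) : V₁ * star V₂ = 0 := by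
  simpa using star_mul_eq_zero_of_orthogonal (V₁ := star V₁) (V₂ := star V₂) hp₁ hp₂
    (by rwa [star_star]) (by rwa [star_star]) h

lemma sub_mul_eq_zero_of_mul_eq {P : A} (hp : IsStarProjection p) (h : p * P = p) :
    p * (P - p) = 0 := by
  rw [mul_sub, h, hp.isIdempotentElem.eq, sub_self]

end PartialIsometry

/-- Gluing a partial isometry from `p` to `q` with one from `P - p` to `Q - q`, keeping track of
how far the two weighted sums are from being intertwined. -/
lemma exists_glue {P Q p q V₁ V₂ S' T' : A} {α β r : ℝ}
    (hP : IsStarProjection P) (hQ : IsStarProjection Q)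
    (hp : IsStarProjection p) (hq : IsStarProjection q) (hpP : p ≤ P) (hqQ : q ≤ Q)
    (h₁ : star V₁ * V₁ = p) (h₁' : V₁ * star V₁ = q)
    (h₂ : star V₂ * V₂ = P - p) (h₂' : V₂ * star V₂ = Q - q)
    (hT : (Q - q) * T' = T') (hT' : T' * (Q - q) = T')
    (hlo : -(r • (P - p)) ≤ S' - star V₂ * T' * V₂) (hhi : S' - star V₂ * T' * V₂ ≤ r • (P - p))
    (hαβ : |α - β| ≤ r ∨ p = 0) :
    ∃ V, star V * V = P ∧ V * star V = Q ∧
      -(r • P) ≤ α • p + S' - star V * (β • q + T') * V ∧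
      α • p + S' - star V * (β • q + T') * V ≤ r • P := by
  have hP' := (hp.le_iff_sub hP).1 hpP
  have hQ' := (hq.le_iff_sub hQ).1 hqQ
  have hpo := sub_mul_eq_zero_of_mul_eq hp ((hp.le_iff_mul_eq_left hP).1 hpP)
  have hqo := sub_mul_eq_zero_of_mul_eq hq ((hq.le_iff_mul_eq_left hQ).1 hqQ)
  have hqo' : (Q - q) * q = 0 := by
    rw [sub_mul, (hq.le_iff_mul_eq_right hQ).1 hqQ, hq.isIdempotentElem.eq, sub_self]
  have z1 : star V₁ * V₂ = 0 := star_mul_eq_zero_of_orthogonal hq hQ' h₁' h₂' hqo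
  have z2 : star V₂ * V₁ = 0 := star_mul_eq_zero_of_orthogonal hQ' hq h₂' h₁' hqo'
  have z3 : V₁ * star V₂ = 0 := mul_star_eq_zero_of_orthogonal hp hP' h₁ h₂ hpo
  have z4 : V₂ * star V₁ = 0 := by simpa using congrArg star z3
  have hqV : q * V₁ = V₁ := mul_of_mul_star_self_eq hq h₁'
  have hqV₂ : q * V₂ = 0 := by
    rw [← mul_of_mul_star_self_eq hQ' h₂', ← mul_assoc, hqo, zero_mul]
  have hTV : T' * V₁ = 0 := by
    rw [← hT', ← hqV, mul_assoc, ← mul_assoc (Q - q), hqo', zero_mul, mul_zero]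
  have hVT : star V₁ * T' = 0 := by
    have : star V₁ * q = star V₁ := by
      simpa [hq.isSelfAdjoint.star_eq] using congrArg star hqV
    rw [← hT, ← this, mul_assoc, ← mul_assoc q, hqo, zero_mul, mul_zero]
  have key : star (V₁ + V₂) * (β • q + T') * (V₁ + V₂) = β • p + star V₂ * T' * V₂ := by
    calc star (V₁ + V₂) * (β • q + T') * (V₁ + V₂)
        = star (V₁ + V₂) * (β • (q * V₁) + β • (q * V₂) + T' * V₁ + T' * V₂) := by
          simp only [mul_assoc, add_mul, mul_add, smul_mul_assoc]
          abel
      _ = β • (star V₁ * V₁) + β • (star V₂ * V₁) + star V₁ * T' * V₂ + star V₂ * T' * V₂ := by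
          rw [hqV, hqV₂, hTV, star_add]
          simp only [mul_assoc, add_mul, mul_add, mul_smul_comm, smul_zero, add_zero, smul_add]
          abel
      _ = β • p + star V₂ * T' * V₂ := by simp [h₁, z2, hVT]
  have hbound : -(r • p) ≤ (α - β) • p ∧ (α - β) • p ≤ r • p := by
    rcases hαβ with h | h
    · rw [← neg_smul]
      exact ⟨smul_le_smul_of_nonneg_right (abs_le.1 h).1 hp.nonneg,
        smul_le_smul_of_nonneg_right (abs_le.1 h).2 hp.nonneg⟩
    · simp [h]
  have e1 : α • p + S' - (β • p + star V₂ * T' * V₂)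
      = (α - β) • p + (S' - star V₂ * T' * V₂) := by rw [sub_smul]; abel
  have e2 : r • P = r • p + r • (P - p) := by rw [← smul_add, add_sub_cancel]
  refine ⟨V₁ + V₂, ?_, ?_, ?_, ?_⟩
  · rw [star_add, add_mul, mul_add, mul_add, h₁, h₂, z1, z2]; abel
  · rw [star_add, add_mul, mul_add, mul_add, h₁', h₂', z3, z4]; abel
  · rw [key, e1, e2, neg_add]
    exact add_le_add hbound.1 hlo
  · rw [key, e1, e2]
    exact add_le_add hbound.2 hhi

/-- Under strong comparison, two weighted decompositions whose step functions are uniformly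
`r`-close are intertwined up to `r` by a partial isometry. The two leading projections are
compared and the smaller one is cut out of the larger, so that one of the lists gets shorter. -/
theorem exists_intertwiner {τ : A →ₚ[ℂ] ℂ} (hτ : IsFaithfulTracialState τ)
    (hcomp : HasStrongComparison τ) (r : ℝ) (L₁ L₂ : List (ℝ × A)) {P Q : A}
    (hP : IsStarProjection P) (hQ : IsStarProjection Q)
    (hL₁ : IsDecomposition P L₁) (hL₂ : IsDecomposition Q L₂)
    (htr : realTrace τ P = realTrace τ Q)
    (hstep : ∀ s ∈ Set.Ico 0 (realTrace τ P), |stepValue τ L₁ s - stepValue τ L₂ s| ≤ r) :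
    ∃ V, star V * V = P ∧ V * star V = Q ∧
      -(r • P) ≤ weightedSum L₁ - star V * weightedSum L₂ * V ∧
      weightedSum L₁ - star V * weightedSum L₂ * V ≤ r • P := by
  match L₁, L₂ with
  | [], L₂ =>
    obtain rfl : P = 0 := hL₁
    have hQ0 : Q = 0 := hτ.eq_zero_of_realTrace_eq_zero hQ (by rw [← htr, map_zero])
    exact ⟨0, by simp [hQ0, weightedSum]⟩
  | L₁, [] =>
    obtain rfl : Q = 0 := hL₂
    have hP0 : P = 0 := hτ.eq_zero_of_realTrace_eq_zero hP (by rw [htr, map_zero])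
    have h0 : weightedSum L₁ = 0 := by
      rw [← mul_weightedSum hP hL₁, hP0, zero_mul]
    exact ⟨0, by simp [hP0, h0]⟩
  | (α, p) :: L₁, (β, q) :: L₂ =>
    obtain ⟨hp, hpP, hL₁⟩ := hL₁
    obtain ⟨hq, hqQ, hL₂⟩ := hL₂
    have hp0 := realTrace_nonneg τ hp.nonneg
    have hq0 := realTrace_nonneg τ hq.nonneg
    have hpP' := realTrace_mono τ hpP
    -- at `s = 0` both step functions take their leading weights
    have first : 0 < realTrace τ p → 0 < realTrace τ q → |α - β| ≤ r := by
      intro h1 h2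
      simpa [stepValue, h1, h2] using hstep 0 ⟨le_rfl, h1.trans_le hpP'⟩
    rcases le_total (realTrace τ p) (realTrace τ q) with hle | hle
    · obtain ⟨q', hq', hq'q, V₁, h₁, h₁'⟩ := hcomp p q hp hq <| by
        rw [← ofReal_realTrace τ hp.nonneg, ← ofReal_realTrace τ hq.nonneg]
        exact_mod_cast hle
      have htr' : realTrace τ q' = realTrace τ p := by
        rw [h₁, h₁', hτ.realTrace_mul_comm]
      have hq'Q := hq'q.trans hqQ
      have hL₂' : IsDecomposition (Q - q') ((β, q - q') :: L₂) := by
        refine ⟨(hq'.le_iff_sub hq).1 hq'q, sub_le_sub_right hqQ _, ?_⟩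
        rwa [sub_sub_sub_cancel_right]
      have hPp := (hp.le_iff_sub hP).1 hpP
      have hQq := (hq'.le_iff_sub hQ).1 hq'Q
      obtain ⟨V₂, h₂, h₂', hlo, hhi⟩ := exists_intertwiner hτ hcomp r L₁ ((β, q - q') :: L₂)
        hPp hQq hL₁ hL₂' (by rw [map_sub, map_sub, htr, htr']) (by
          intro s hs
          rw [map_sub] at hs
          have h := hstep (s + realTrace τ p) ⟨by linarith [hs.1], by linarith [hs.2]⟩
          have hc : ¬ s + realTrace τ p < realTrace τ p := by linarith [hs.1]
          rw [stepValue, if_neg hc, add_sub_cancel_right] at h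
          have e : stepValue τ ((β, q) :: L₂) (s + realTrace τ p)
              = stepValue τ ((β, q - q') :: L₂) s := by
            simp only [stepValue, map_sub, htr', lt_sub_iff_add_lt]
            congr 2
            ring
          rwa [e] at h)
      obtain ⟨V, hV, hV', hVlo, hVhi⟩ := exists_glue (α := α) (β := β) hP hQ hp hq' hpP hq'Q h₁.symm
        h₁'.symm h₂ h₂' (mul_weightedSum hQq hL₂') (weightedSum_mul hQq hL₂') hlo hhi (by
          rcases hp0.eq_or_lt with h | h
          · exact Or.inr (hτ.eq_zero_of_realTrace_eq_zero hp h.symm)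
          · exact Or.inl (first h (h.trans_le hle)))
      have e : β • q' + weightedSum ((β, q - q') :: L₂) = weightedSum ((β, q) :: L₂) := by
        rw [weightedSum, weightedSum, ← add_assoc, ← smul_add, add_sub_cancel]
      rw [e] at hVlo hVhi
      exact ⟨V, hV, hV', hVlo, hVhi⟩
    · obtain ⟨p', hp', hp'p, V₁, h₁, h₁'⟩ := hcomp q p hq hp <| by
        rw [← ofReal_realTrace τ hp.nonneg, ← ofReal_realTrace τ hq.nonneg]
        exact_mod_cast hle
      have htr' : realTrace τ p' = realTrace τ q := by
        rw [h₁, h₁', hτ.realTrace_mul_comm]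
      have hp'P := hp'p.trans hpP
      have hL₁' : IsDecomposition (P - p') ((α, p - p') :: L₁) := by
        refine ⟨(hp'.le_iff_sub hp).1 hp'p, sub_le_sub_right hpP _, ?_⟩
        rwa [sub_sub_sub_cancel_right]
      have hPp := (hp'.le_iff_sub hP).1 hp'P
      have hQq := (hq.le_iff_sub hQ).1 hqQ
      obtain ⟨V₂, h₂, h₂', hlo, hhi⟩ := exists_intertwiner hτ hcomp r ((α, p - p') :: L₁) L₂
        hPp hQq hL₁' hL₂ (by rw [map_sub, map_sub, htr, htr']) (by
          intro s hs
          rw [map_sub] at hs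
          have h := hstep (s + realTrace τ q) ⟨by linarith [hs.1], by linarith [hs.2]⟩
          have hc : ¬ s + realTrace τ q < realTrace τ q := by linarith [hs.1]
          rw [stepValue.eq_2 τ _ β q L₂, if_neg hc, add_sub_cancel_right] at h
          have e : stepValue τ ((α, p) :: L₁) (s + realTrace τ q)
              = stepValue τ ((α, p - p') :: L₁) s := by
            simp only [stepValue, map_sub, htr', lt_sub_iff_add_lt]
            congr 2
            ring
          rwa [e] at h)
      obtain ⟨V, hV, hV', hVlo, hVhi⟩ := exists_glue (α := α) (β := β) (V₁ := star V₁) hP hQ hp' hq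
        hp'P hqQ (by rw [star_star, h₁']) (by rw [star_star, h₁]) h₂ h₂'
        (mul_weightedSum hQq hL₂) (weightedSum_mul hQq hL₂) hlo hhi (by
          rcases hq0.eq_or_lt with h | h
          · exact Or.inr (hτ.eq_zero_of_realTrace_eq_zero hp' (htr'.trans h.symm))
          · exact Or.inl (first (h.trans_le hle) h))
      have e : α • p' + weightedSum ((α, p - p') :: L₁) = weightedSum ((α, p) :: L₁) := by
        rw [weightedSum, weightedSum, ← add_assoc, ← smul_add, add_sub_cancel]
      rw [e] at hVlo hVhi
      exact ⟨V, hV, hV', hVlo, hVhi⟩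
termination_by L₁.length + L₂.length

/-! ### Approximation by weighted decompositions -/

/-- The spectral projections of `b` for the first `k` intervals `(t i, t (i + 1)]` of a grid,
weighted by the left endpoints and listed in decreasing order. -/
def gridList {A : Type*} [CStarAlgebra A] (b : A) (t : ℕ → ℝ) : ℕ → List (ℝ × A)
  | 0 => []
  | k + 1 => (t k, cfc (stepFun (t k)) b - cfc (stepFun (t (k + 1))) b) :: gridList b t k

/-- The function rounding `x` down to the grid `t` on `(t 0, t k]`, and vanishing elsewhere. -/
def gridFun (t : ℕ → ℝ) : ℕ → ℝ → ℝ
  | 0, _ => 0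
  | k + 1, x => t k * (stepFun (t k) x - stepFun (t (k + 1)) x) + gridFun t k x

lemma gridFun_of_lt {t : ℕ → ℝ} (ht : Monotone t) {k : ℕ} {x : ℝ} (hx : t k < x) :
    gridFun t k x = 0 := by
  induction k with
  | zero => rfl
  | succ k ih =>
    have h : t k < x := (ht k.le_succ).trans_lt hx
    rw [gridFun, ih h, stepFun, stepFun, if_pos h, if_pos hx]
    simp

lemma abs_gridFun_sub_le {t : ℕ → ℝ} (ht : Monotone t) {δ : ℝ} (hδ : ∀ i, t (i + 1) ≤ t i + δ)
    {k : ℕ} {x : ℝ} (h0 : t 0 < x) (hx : x ≤ t k) : |gridFun t k x - x| ≤ δ := by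
  induction k with
  | zero => linarith
  | succ k ih =>
    rw [gridFun, stepFun, stepFun, if_neg hx.not_gt]
    rcases lt_or_ge (t k) x with h | h
    · rw [gridFun_of_lt ht h, if_pos h, abs_le]
      constructor <;> linarith [hδ k]
    · rw [if_neg h.not_gt]
      simpa using ih h

lemma continuousOn_gridFun {t : ℕ → ℝ} {s : Set ℝ} {k : ℕ} (h : ∀ i ≤ k, t i ∉ s) :
    ContinuousOn (gridFun t k) s := by
  induction k with
  | zero => exact continuousOn_const
  | succ k ih =>
    exact (continuousOn_const.mul ((continuousOn_stepFun (h k k.le_succ)).sub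
      (continuousOn_stepFun (h (k + 1) le_rfl)))).add (ih fun i hi => h i (hi.trans k.le_succ))

lemma weightedSum_gridList {A : Type*} [CStarAlgebra A] {b : A}
    {t : ℕ → ℝ} {k : ℕ} (h : ∀ i ≤ k, t i ∉ spectrum ℝ b) :
    weightedSum (gridList b t k) = cfc (gridFun t k) b := by
  induction k with
  | zero => exact (cfc_const_zero ℝ b).symm
  | succ k ih =>
    have h' : ∀ i ≤ k, t i ∉ spectrum ℝ b := fun i hi => h i (hi.trans k.le_succ)
    have c1 := continuousOn_stepFun (h k k.le_succ)
    have c2 := continuousOn_stepFun (h (k + 1) le_rfl)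
    have c3 : ContinuousOn (fun x => stepFun (t k) x - stepFun (t (k + 1)) x) (spectrum ℝ b) :=
      c1.sub c2
    have c4 : ContinuousOn (fun x => t k * (stepFun (t k) x - stepFun (t (k + 1)) x))
        (spectrum ℝ b) := continuousOn_const.mul c3
    rw [gridList, weightedSum, ih h', ← cfc_sub _ _ b c1 c2, ← cfc_const_mul _ _ b c3,
      ← cfc_add b _ _ c4 (continuousOn_gridFun h')]
    rfl

lemma isDecomposition_gridList {b : A} {t : ℕ → ℝ} (ht : Monotone t)
    (h0 : cfc (stepFun (t 0)) b = 1) {k : ℕ} (h : ∀ i ≤ k, t i ∉ spectrum ℝ b) :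
    IsDecomposition (1 - cfc (stepFun (t k)) b) (gridList b t k) := by
  induction k with
  | zero => exact sub_eq_zero.2 h0.symm
  | succ k ih =>
    have h' : ∀ i ≤ k, t i ∉ spectrum ℝ b := fun i hi => h i (hi.trans k.le_succ)
    have hk := isStarProjection_cfc_stepFun (h' k le_rfl)
    have hk1 := isStarProjection_cfc_stepFun (h (k + 1) le_rfl)
    refine ⟨(hk1.le_iff_sub hk).1 (cfc_stepFun_anti (h' k le_rfl) (h (k + 1) le_rfl)
      (ht k.le_succ)), sub_le_sub_right ?_ _, ?_⟩
    · exact sub_nonneg.1 hk.one_sub.nonneg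
    · rw [sub_sub_sub_cancel_right]
      exact ih h'

lemma abs_stepValue_gridList_sub_le {τ : A →ₚ[ℂ] ℂ} (hτ : IsFaithfulTracialState τ) {b : A}
    (hb : IsSelfAdjoint b) {t : ℕ → ℝ} {δ : ℝ} (hδ : ∀ i, t (i + 1) ≤ t i + δ)
    (h0 : cfc (stepFun (t 0)) b = 1) {k : ℕ} (h : ∀ i ≤ k, t i ∉ spectrum ℝ b) {s : ℝ}
    (hs0 : 0 ≤ s) (hs : realTrace τ (cfc (stepFun (t k)) b) ≤ s) (hs1 : s < 1) :
    |stepValue τ (gridList b t k) (s - realTrace τ (cfc (stepFun (t k)) b))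
      - eigenvalueFun τ b s| ≤ δ := by
  induction k with
  | zero =>
    rw [h0, hτ.realTrace_one] at hs
    exact absurd hs1 hs.not_gt
  | succ k ih =>
    have h' : ∀ i ≤ k, t i ∉ spectrum ℝ b := fun i hi => h i (hi.trans k.le_succ)
    have hk := upperMass_of_notMem_spectrum hτ hb (h' k le_rfl)
    have hk1 := upperMass_of_notMem_spectrum hτ hb (h (k + 1) le_rfl)
    rw [gridList, stepValue, map_sub, sub_sub_sub_cancel_right]
    split_ifs with hlt <;> rw [sub_lt_sub_iff_right] at hlt
    · have h1 := (lt_eigenvalueFun_iff hτ hb ⟨hs0, hs1⟩).2 (hk ▸ hlt)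
      have h2 := (eigenvalueFun_le_iff hτ hb ⟨hs0, hs1⟩).2 (hk1 ▸ hs)
      rw [abs_le]
      constructor <;> linarith [hδ k]
    · exact ih h' (not_lt.1 hlt)

/-- In real rank zero, every self-adjoint element is close to a weighted decomposition of the unit
whose step function is close to the eigenvalue function. -/
theorem HasRealRankZero.exists_weightedSum_near (hA : HasRealRankZero A) {τ : A →ₚ[ℂ] ℂ}
    (hτ : IsFaithfulTracialState τ) {S : A} (hS : IsSelfAdjoint S) {ε : ℝ} (hε : 0 < ε) :
    ∃ L : List (ℝ × A), IsDecomposition 1 L ∧ ‖S - weightedSum L‖ ≤ ε ∧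
      ∀ s ∈ Set.Ico (0 : ℝ) 1, |stepValue τ L s - eigenvalueFun τ S s| ≤ ε := by
  set δ : ℝ := ε / 2
  have hδ0 : 0 < δ := half_pos hε
  set M : ℝ := ‖S‖ + δ
  have hM0 : 0 < M := by positivity
  -- a grid of mesh `δ` from `-2 * M` to beyond `M`
  set t : ℕ → ℝ := fun i => -2 * M + i * δ with ht
  obtain ⟨n, hn⟩ := exists_nat_gt (3 * M / δ)
  rw [div_lt_iff₀ hδ0] at hn
  have htm : Monotone t := fun i j h => by
    have : (i : ℝ) ≤ j := by exact_mod_cast h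
    simp only [ht]
    gcongr
  have htδ : ∀ i, t (i + 1) ≤ t i + δ := fun i => by simp only [ht]; push_cast; linarith
  have ht0 : t 0 = -2 * M := by simp [ht]
  have htn : M < t n := by simp only [ht]; linarith
  obtain ⟨b, hbS, hb, hbt⟩ := hA.exists_mem_forall_notMem_spectrum
    ((Finset.range (n + 1)).image t) hS (Metric.isOpen_ball (x := S) (ε := δ))
    (Metric.mem_ball_self hδ0)
  have hgap : ∀ i ≤ n, t i ∉ spectrum ℝ b := fun i hi =>
    hbt _ (Finset.mem_image_of_mem t (Finset.mem_range.2 (Nat.lt_succ_of_le hi)))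
  rw [mem_ball_iff_norm] at hbS
  have hbM : ‖b‖ ≤ M := by
    have h : ‖S + (b - S)‖ ≤ ‖S‖ + ‖b - S‖ := norm_add_le _ _
    rw [add_sub_cancel] at h
    linarith
  have hspec : ∀ x ∈ spectrum ℝ b, t 0 < x ∧ x < t n := fun x hx => by
    have := spectrum_subset_Icc hb hbM hx
    rw [ht0]
    constructor <;> linarith [this.1, this.2]
  have h0 : cfc (stepFun (t 0)) b = 1 := by
    rw [← cfc_const_one ℝ b]
    exact cfc_congr fun x hx => if_pos (hspec x hx).1
  have hend : cfc (stepFun (t n)) b = 0 := by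
    rw [← cfc_const_zero ℝ b]
    exact cfc_congr fun x hx => if_neg (hspec x hx).2.not_gt
  refine ⟨gridList b t n, ?_, ?_, fun s hs => ?_⟩
  · simpa [hend] using isDecomposition_gridList htm h0 hgap
  · have h1 : ‖weightedSum (gridList b t n) - b‖ ≤ δ := by
      have e : weightedSum (gridList b t n) - b = cfc (fun x => gridFun t n x - x) b := by
        rw [cfc_sub _ (fun x => x) b (continuousOn_gridFun hgap) (continuousOn_id' _), cfc_id' ℝ b,
          weightedSum_gridList hgap]
      rw [e]
      exact norm_cfc_le hδ0.le fun x hx =>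
        abs_gridFun_sub_le htm htδ (hspec x hx).1 (hspec x hx).2.le
    calc ‖S - weightedSum (gridList b t n)‖
        = ‖(b - S) + (weightedSum (gridList b t n) - b)‖ := by rw [← norm_neg]; congr 1; abel
      _ ≤ δ + δ := (norm_add_le _ _).trans (add_le_add hbS.le h1)
      _ = ε := add_halves ε
  · have h1 := abs_stepValue_gridList_sub_le hτ hb htδ h0 hgap hs.1
      (by rw [hend, map_zero]; exact hs.1) hs.2
    rw [hend, map_zero, sub_zero] at h1
    have h2 := (abs_eigenvalueFun_sub_le hτ hb hS hs).trans hbS.le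
    calc |stepValue τ (gridList b t n) s - eigenvalueFun τ S s|
        ≤ δ + δ := (abs_sub_le _ (eigenvalueFun τ b s) _).trans (add_le_add h1 h2)
      _ = ε := add_halves ε

/-! ### The distance between unitary orbits -/

lemma norm_le_of_neg_le_of_le {D : A} (hD : IsSelfAdjoint D) {r : ℝ} (hr : 0 ≤ r)
    (hlo : -(r • (1 : A)) ≤ D) (hhi : D ≤ r • (1 : A)) : ‖D‖ ≤ r := by
  rw [← Algebra.algebraMap_eq_smul_one] at hlo hhi
  rw [← map_neg] at hlo
  rw [← cfc_id' ℝ D]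
  exact norm_cfc_le hr fun x hx => abs_le.2
    ⟨(algebraMap_le_iff_le_spectrum hD).1 hlo x hx, (le_algebraMap_iff_spectrum_le hD).1 hhi x hx⟩

section Orbit

variable {A : Type*} [CStarAlgebra A]

lemma norm_star_mul_mul_le {U : A} (hU : U ∈ unitary A) (a : A) : ‖star U * a * U‖ ≤ ‖a‖ := by
  rw [CStarRing.norm_mul_mem_unitary _ hU, CStarRing.norm_mem_unitary_mul _ (Unitary.star_mem hU)]

lemma mem_unitaryOrbit_self (T : A) : T ∈ unitaryOrbit T := ⟨1, one_mem _, by simp⟩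

lemma isSelfAdjoint_of_mem_unitaryOrbit {T x : A} (hT : IsSelfAdjoint T)
    (hx : x ∈ unitaryOrbit T) : IsSelfAdjoint x := by
  obtain ⟨U, _, rfl⟩ := hx
  simpa using hT.conjugate (star U)

lemma mem_closure_unitaryOrbit_of_forall {S T : A}
    (h : ∀ ε > 0, ∃ U ∈ unitary A, ‖S - star U * T * U‖ ≤ ε) : S ∈ closure (unitaryOrbit T) := by
  refine Metric.mem_closure_iff.2 fun ε hε => ?_
  obtain ⟨U, hU, hle⟩ := h (ε / 2) (half_pos hε)
  exact ⟨_, ⟨U, hU, rfl⟩, by rw [dist_eq_norm]; linarith⟩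

lemma unitaryOrbit_subset_closure {S T : A}
    (h : ∀ ε > 0, ∃ U ∈ unitary A, ‖S - star U * T * U‖ ≤ ε) :
    closure (unitaryOrbit S) ⊆ closure (unitaryOrbit T) := by
  refine closure_minimal ?_ isClosed_closure
  rintro _ ⟨W, hW, rfl⟩
  refine mem_closure_unitaryOrbit_of_forall fun ε hε => ?_
  obtain ⟨U, hU, hle⟩ := h ε hε
  refine ⟨U * W, mul_mem hU hW, ?_⟩
  have e : star W * S * W - star (U * W) * T * (U * W) = star W * (S - star U * T * U) * W := by
    rw [star_mul]; noncomm_ring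
  rw [e]
  exact (norm_star_mul_mul_le hW _).trans hle

lemma bddBelow_norm_sub (X Y : Set A) : BddBelow {r : ℝ | ∃ x ∈ X, ∃ y ∈ Y, r = ‖x - y‖} :=
  ⟨0, by rintro _ ⟨x, _, y, _, rfl⟩; exact norm_nonneg _⟩

end Orbit

/-- A uniform bound for the difference of the eigenvalue functions is also a bound, up to an
arbitrarily small error, for the norm distance after a suitable unitary conjugation. -/
theorem exists_unitary_norm_sub_le (hA : HasRealRankZero A) {τ : A →ₚ[ℂ] ℂ}
    (hτ : IsFaithfulTracialState τ) (hcomp : HasStrongComparison τ) {S T : A}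
    (hS : IsSelfAdjoint S) (hT : IsSelfAdjoint T) {r : ℝ}
    (hr : ∀ s ∈ Set.Ico (0 : ℝ) 1, |eigenvalueFun τ S s - eigenvalueFun τ T s| ≤ r) {ε : ℝ}
    (hε : 0 < ε) : ∃ U ∈ unitary A, ‖S - star U * T * U‖ ≤ r + ε := by
  have hη : 0 < ε / 4 := by positivity
  obtain ⟨L₁, hL₁, hSL, hstep₁⟩ := hA.exists_weightedSum_near hτ hS hη
  obtain ⟨L₂, hL₂, hTL, hstep₂⟩ := hA.exists_weightedSum_near hτ hT hη
  have hr0 : 0 ≤ r := (abs_nonneg _).trans (hr 0 ⟨le_rfl, zero_lt_one⟩)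
  obtain ⟨V, hV, hV', hlo, hhi⟩ := exists_intertwiner hτ hcomp (r + ε / 2) L₁ L₂
    (.one A) (.one A) hL₁ hL₂ rfl <| by
      intro s hs
      rw [hτ.realTrace_one] at hs
      have h1 := abs_le.1 (hstep₁ s hs)
      have h2 := abs_le.1 (hstep₂ s hs)
      have h3 := abs_le.1 (hr s hs)
      rw [abs_le]
      constructor <;> linarith [h1.1, h1.2, h2.1, h2.2, h3.1, h3.2]
  have hU : V ∈ unitary A := Unitary.mem_iff.2 ⟨hV, hV'⟩
  refine ⟨V, hU, ?_⟩
  have hsa : IsSelfAdjoint (weightedSum L₁ - star V * weightedSum L₂ * V) :=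
    (isSelfAdjoint_weightedSum hL₁).sub (isSelfAdjoint_of_mem_unitaryOrbit
      (isSelfAdjoint_weightedSum hL₂) ⟨V, hU, rfl⟩)
  have h1 := norm_le_of_neg_le_of_le hsa (by positivity) hlo hhi
  have h2 := (norm_star_mul_mul_le hU (T - weightedSum L₂)).trans hTL
  have e : S - star V * T * V = (S - weightedSum L₁)
      + (weightedSum L₁ - star V * weightedSum L₂ * V)
      - star V * (T - weightedSum L₂) * V := by noncomm_ring
  rw [e]
  have h3 := norm_sub_le ((S - weightedSum L₁)
      + (weightedSum L₁ - star V * weightedSum L₂ * V)) (star V * (T - weightedSum L₂) * V)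
  have h4 := norm_add_le (S - weightedSum L₁) (weightedSum L₁ - star V * weightedSum L₂ * V)
  linarith

lemma abs_eigenvalueFun_sub_le_of_mem_unitaryOrbit {τ : A →ₚ[ℂ] ℂ} (hτ : IsFaithfulTracialState τ)
    {S T x y : A} (hS : IsSelfAdjoint S) (hT : IsSelfAdjoint T) (hx : x ∈ unitaryOrbit S)
    (hy : y ∈ unitaryOrbit T) {s : ℝ} (hs : s ∈ Set.Ico (0 : ℝ) 1) :
    |eigenvalueFun τ S s - eigenvalueFun τ T s| ≤ ‖x - y‖ := by
  have h := abs_eigenvalueFun_sub_le hτ (isSelfAdjoint_of_mem_unitaryOrbit hS hx)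
    (isSelfAdjoint_of_mem_unitaryOrbit hT hy) hs
  obtain ⟨U, hU, rfl⟩ := hx
  obtain ⟨W, hW, rfl⟩ := hy
  rwa [eigenvalueFun_conj_unitary hτ hS hU, eigenvalueFun_conj_unitary hτ hT hW] at h

end

theorem mainTheorem7 {A : Type*} [CStarAlgebra A] [PartialOrder A] [StarOrderedRing A]
    (hA : HasRealRankZero A) (τ : A →ₚ[ℂ] ℂ) (hτ : IsFaithfulTracialState τ)
    (hcomp : HasStrongComparison τ) (S T : A) (hS : IsSelfAdjoint S) (hT : IsSelfAdjoint T) :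
    IsLUB {r : ℝ | ∃ s ∈ Set.Ico (0 : ℝ) 1, r = |eigenvalueFun τ S s - eigenvalueFun τ T s|}
      (distBetween (unitaryOrbit S) (unitaryOrbit T)) ∧
    (ApproxUnitarilyEquivalent S T ↔
      ∀ s ∈ Set.Ico (0 : ℝ) 1, eigenvalueFun τ S s = eigenvalueFun τ T s) ∧
    ((∀ s ∈ Set.Ico (0 : ℝ) 1, eigenvalueFun τ S s = eigenvalueFun τ T s) ↔
      TraceMajorizes τ T S ∧ TraceMajorizes τ S T) := by
  refine ⟨⟨?_, fun r hr => ?_⟩, ⟨fun h s hs => ?_, fun h => ?_⟩,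
    traceMajorizes_antisymm_iff hτ hS hT⟩
  · rintro _ ⟨s, hs, rfl⟩
    refine le_csInf ⟨_, S, mem_unitaryOrbit_self S, T, mem_unitaryOrbit_self T, rfl⟩ ?_
    rintro _ ⟨x, hx, y, hy, rfl⟩
    exact abs_eigenvalueFun_sub_le_of_mem_unitaryOrbit hτ hS hT hx hy hs
  · refine le_of_forall_pos_le_add fun ε hε => ?_
    obtain ⟨U, hU, hle⟩ := exists_unitary_norm_sub_le hA hτ hcomp hS hT
      (fun s hs => hr ⟨s, hs, rfl⟩) hε
    exact le_trans (csInf_le (bddBelow_norm_sub _ _)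
      ⟨S, mem_unitaryOrbit_self S, star U * T * U, ⟨U, hU, rfl⟩, rfl⟩) hle
  · have hmem : S ∈ closure (unitaryOrbit T) := h ▸ subset_closure (mem_unitaryOrbit_self S)
    refine sub_eq_zero.1 (abs_nonpos_iff.1 (le_of_forall_pos_le_add fun ε hε => ?_))
    obtain ⟨y, hy, hd⟩ := Metric.mem_closure_iff.1 hmem ε hε
    rw [dist_eq_norm] at hd
    rw [zero_add]
    exact (abs_eigenvalueFun_sub_le_of_mem_unitaryOrbit hτ hS hT (mem_unitaryOrbit_self S)
      hy hs).trans hd.le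
  · have key : ∀ {R R' : A}, IsSelfAdjoint R → IsSelfAdjoint R' →
        (∀ s ∈ Set.Ico (0 : ℝ) 1, eigenvalueFun τ R s = eigenvalueFun τ R' s) →
        closure (unitaryOrbit R) ⊆ closure (unitaryOrbit R') := by
      intro R R' hR hR' hRR'
      refine unitaryOrbit_subset_closure fun ε hε => ?_
      simpa using exists_unitary_norm_sub_le hA hτ hcomp hR hR' (r := 0)
        (fun s hs => by rw [hRR' s hs, sub_self, abs_zero]) hε
    exact (key hS hT h).antisymm (key hT hS fun s hs => (h s hs).symm)
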